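/- A \emph{Heron triangle} is a (nondegenerate) triangle in the Euclidean plane whose three side lengths and whose area are integers. For every positive integer $N$ there exists an infinite family, parametrized by $s \in \mathbb{Z}_{>0}$, of $N$-tuples $(\Delta_1(s),\dots,\Delta_N(s))$ of Heron triangles such that 1. for every $s \in \mathbb{Z}_{>0}$ the triangles $\Delta_1(s),\dots,\Delta_N(s)$ are pairwise nonsimilar; 2. for every $s \in \mathbb{Z}_{>0}$ all $N$ triangles $\Delta_1(s),\dots,\Delta_N(s)$ have the same area $A(s)$ and the same perimeter $p(s)$; 3. for any two different $s, s' \in \mathbb{Z}_{>0}$ the ratios $A(s)/p(s)^2$ and $A(s')/p(s')^2$ are different. -/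

import Mathlib

open MeasureTheory

noncomputable section

/-- Nondegenerate triangles (with labelled vertices) in the Euclidean plane. -/
abbrev PlaneTriangle : Type := Affine.Triangle ℝ (EuclideanSpace ℝ (Fin 2))

namespace PlaneTriangle

/-- The length of the side opposite the vertex with label `i`. -/
def side (T : PlaneTriangle) (i : Fin 3) : ℝ :=
  dist (T.points (i + 1)) (T.points (i + 2))

/-- The perimeter: the sum of the three side lengths. -/
def perimeter (T : PlaneTriangle) : ℝ := ∑ i, T.side i

/-- The area: the Lebesgue measure of the triangular region spanned by the vertices. -/
def area (T : PlaneTriangle) : ℝ := volume.real (convexHull ℝ (Set.range T.points))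

/-- A Heron triangle is a triangle with integral sides and integral area. -/
def IsHeron (T : PlaneTriangle) : Prop :=
  (∀ i, ∃ n : ℤ, T.side i = n) ∧ ∃ n : ℤ, T.area = n

/-- Two triangles are similar if, after relabelling the vertices of one of them, all distances
between corresponding vertices are in the same ratio. -/
def IsSimilar (T T' : PlaneTriangle) : Prop :=
  ∃ e : Equiv.Perm (Fin 3), Similar (T.points ∘ e) T'.points

end PlaneTriangle

end

/-! A triangle with tangent lengths `u, v, w` has sides `v + w, u + w, u + v` and squared area `(u +
v + w) * u * v * w`. So with `u + v + w = 1` and `u * v * w = k ^ 2`, area over squared perimeter is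
`k / 4`, and the task is to find many positive rational points on this cubic. In `X = 1 / w`, `Y =
(u - v) / w` it reads `Y² = (X - 1)² - c X³` with `c = 4k²`, an elliptic curve through `P = (4, h)`
when `c = coeff h`.

At `h = 0` the point `P` is 2-torsion, so as `h → 0` every odd multiple `(2n + 1)P` tends to `(4,
0)`, which gives positivity. Its ordinate divided by `h` tends to `2n + 1` (`continuousAt_orbit`),
so any `N` of these points are distinct for small `h ≠ 0`, and `uv + vw + wu` tells their triangles
apart. Finally `h` runs through values tending to 0 for which `k` is rational, and denominators are
cleared by scaling. -/

namespace HeronCurve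

open Filter Topology

/-! ### Translation by `2P` on the elliptic curve -/

/-- Four times the product `u v w` on the curve through the base point. -/
def coeff (h : ℚ) : ℚ := (9 - h ^ 2) / 64

/-- `h²` times the abscissa of the double of the base point `(4, h)`. -/
def dblX (h : ℚ) : ℚ := (64 * h ^ 2 - 9 * (1 - h ^ 2) ^ 2) / (9 - h ^ 2) - 8 * h ^ 2

/-- `h³` times the ordinate of the double of the base point `(4, h)`. -/
def dblY (h : ℚ) : ℚ := -h ^ 4 + 3 / 8 * (1 - h ^ 2) * (dblX h - 4 * h ^ 2)

theorem dbl_on_curve {h : ℚ} (hh : 9 - h ^ 2 ≠ 0) :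
    dblY h ^ 2 = h ^ 2 * (dblX h - h ^ 2) ^ 2 - coeff h * dblX h ^ 3 := by
  unfold dblY dblX coeff
  field_simp
  ring

/-- `h⁻¹` times the inverse slope of the chord from `q` to the double of the base point. -/
def slope (h : ℚ) (q : ℚ × ℚ) : ℚ := (dblX h - h ^ 2 * q.1) / (dblY h - h ^ 4 * q.2)

/-- `h⁻¹` times the difference of ordinates between the third point of that chord and `q`. -/
def shift (h : ℚ) (q : ℚ × ℚ) : ℚ :=
  (2 * q.2 - (2 * (q.1 - 1) - 3 * coeff h * q.1 ^ 2) * slope h q) /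
    (coeff h * slope h q ^ 2 * (dblX h - h ^ 2 * q.1))

/-- Translation by the double of the base point. -/
def step (h : ℚ) (q : ℚ × ℚ) : ℚ × ℚ :=
  (q.1 + h ^ 2 * slope h q * shift h q, -(q.2 + shift h q))

/-- The point with abscissa `q.1` and ordinate `h * q.2` lies on `Y² = (X - 1)² - c X³`. -/
def OnCurve (h : ℚ) (q : ℚ × ℚ) : Prop :=
  h ^ 2 * q.2 ^ 2 = (q.1 - 1) ^ 2 - coeff h * q.1 ^ 3

/-- Translation by the double of the base point preserves the curve. -/
theorem step_onCurve {h : ℚ} {q : ℚ × ℚ} (hh : 9 - h ^ 2 ≠ 0)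
    (hN : dblX h - h ^ 2 * q.1 ≠ 0) (hD : dblY h - h ^ 4 * q.2 ≠ 0) (hq : OnCurve h q) :
    OnCurve h (step h q) := by
  have hR := dbl_on_curve hh
  obtain ⟨X, Z⟩ := q
  simp only [OnCurve, step] at *
  have hc : coeff h ≠ 0 := by unfold coeff; positivity
  have hθ : slope h (X, Z) * (dblY h - h ^ 4 * Z) = dblX h - h ^ 2 * X := by
    simp only [slope]; field_simp
  have hθ0 : slope h (X, Z) ≠ 0 := by
    intro h; rw [h, zero_mul] at hθ; exact hN hθ.symm
  have hS : shift h (X, Z) * (coeff h * slope h (X, Z) ^ 2 * (dblX h - h ^ 2 * X)) =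
      2 * Z - (2 * (X - 1) - 3 * coeff h * X ^ 2) * slope h (X, Z) := by
    exact div_mul_cancel₀ _ (mul_ne_zero (mul_ne_zero hc (pow_ne_zero 2 hθ0)) hN)
  generalize slope h (X, Z) = θ at *
  generalize shift h (X, Z) = S at *
  generalize coeff h = c at *
  obtain ⟨D, hDe⟩ : ∃ D, dblY h - h ^ 4 * Z = D := ⟨_, rfl⟩
  have e1 : dblY h = D + h ^ 4 * Z := by linarith
  have e2 : dblX h = θ * D + h ^ 2 * X := by rw [← hDe]; linarith
  rw [e1, e2] at hR
  have e3 : dblX h - h ^ 2 * X = θ * D := by rw [e2]; ring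
  rw [e3] at hS hN
  rw [hDe] at hD
  -- the residual quadratic at the doubled point
  have hquad : c * θ ^ 3 * D ^ 2 + (1 - (1 - 3 * c * X) * h ^ 2 * θ ^ 2) * D +
      h ^ 4 * (2 * Z - (2 * (X - 1) - 3 * c * X ^ 2) * θ) = 0 := by
    apply mul_left_cancel₀ hD
    linear_combination hR - h ^ 6 * hq
  -- Since `D / h ^ 4` is one root, Vieta makes `S` the other. Using the product of the roots, not
  -- their sum, keeps `shift` free of a pole at `h = 0`.
  have hq2 : c * h ^ 4 * θ ^ 3 * S ^ 2 + (1 - (1 - 3 * c * X) * h ^ 2 * θ ^ 2) * S +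
      (2 * Z - (2 * (X - 1) - 3 * c * X ^ 2) * θ) = 0 := by
    rw [← hS] at hquad ⊢
    apply mul_left_cancel₀ hD
    linear_combination S * hquad
  linear_combination hq + h ^ 2 * S * hq2

/-- The odd multiples of the base point `(4, h)`. -/
def orbit (h : ℚ) : ℕ → ℚ × ℚ
  | 0 => (4, 1)
  | n + 1 => step h (orbit h n)

theorem orbit_zero_onCurve (h : ℚ) : OnCurve h (orbit h 0) := by
  simp only [OnCurve, orbit, coeff]; ring

/-! ### Behaviour of the odd multiples as `h → 0` -/

/-- `2P` escapes to infinity as `h → 0`, but in the rescaled coordinates translation by it extends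
continuously to `h = 0`, where it fixes the abscissa 4 and adds 2 to the ordinate. -/
theorem continuousAt_orbit (n : ℕ) :
    ContinuousAt (fun h => orbit h n) 0 ∧ orbit 0 n = (4, 2 * (n : ℚ) + 1) := by
  have hX : ContinuousAt dblX 0 := by
    unfold dblX
    fun_prop (disch := norm_num)
  have hY : ContinuousAt dblY 0 := by
    unfold dblY
    fun_prop
  have hc : ContinuousAt coeff 0 := by
    unfold coeff
    fun_prop
  have vX : dblX 0 = -1 := by norm_num [dblX]
  have vY : dblY 0 = -3 / 8 := by norm_num [dblY, vX]
  have vc : coeff 0 = 9 / 64 := by norm_num [coeff]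
  induction n with
  | zero => exact ⟨continuousAt_const, by norm_num [orbit]⟩
  | succ n ih =>
    obtain ⟨ih, iv⟩ := ih
    have vs : slope 0 (orbit 0 n) = 8 / 3 := by norm_num [slope, vX, vY]
    have vS : shift 0 (orbit 0 n) = -(4 * n + 4) := by
      rw [shift, vs, vc, vX, iv]; ring
    have cs : ContinuousAt (fun h => slope h (orbit h n)) 0 := by
      unfold slope
      fun_prop (disch := norm_num [vY])
    have cS : ContinuousAt (fun h => shift h (orbit h n)) 0 := by
      unfold shift
      fun_prop (disch := norm_num [vX, vc, vs])
    constructor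
    · simp only [orbit, step]
      fun_prop
    · simp only [orbit, step, vS]
      rw [iv]
      ext
      · simp
      · push_cast; ring

theorem eventually_ne_zero {f : ℚ → ℚ} (hf : ContinuousAt f 0) (h0 : f 0 ≠ 0) :
    ∀ᶠ h in 𝓝[≠] (0 : ℚ), f h ≠ 0 :=
  eventually_nhdsWithin_of_eventually_nhds (hf.eventually_ne h0)

theorem eventually_orbit_onCurve (n : ℕ) : ∀ᶠ h in 𝓝[≠] (0 : ℚ), OnCurve h (orbit h n) := by
  induction n with
  | zero => exact Eventually.of_forall orbit_zero_onCurve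
  | succ n ih =>
    obtain ⟨co, -⟩ := continuousAt_orbit n
    have hX : ContinuousAt dblX 0 := by
      unfold dblX
      fun_prop (disch := norm_num)
    have hY : ContinuousAt dblY 0 := by
      unfold dblY
      fun_prop
    have h9 : ∀ᶠ h in 𝓝[≠] (0 : ℚ), 9 - h ^ 2 ≠ 0 :=
      
      (eventually_ne_zero (f := fun h : ℚ => 9 - h ^ 2) (by fun_prop) (by norm_num))
    have hN : ∀ᶠ h in 𝓝[≠] (0 : ℚ), dblX h - h ^ 2 * (orbit h n).1 ≠ 0 :=
      
      (eventually_ne_zero (f := fun h : ℚ => dblX h - h ^ 2 * (orbit h n).1)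
          (by fun_prop) (by norm_num [dblX]))
    have hD : ∀ᶠ h in 𝓝[≠] (0 : ℚ), dblY h - h ^ 4 * (orbit h n).2 ≠ 0 :=
      
      (eventually_ne_zero (f := fun h : ℚ => dblY h - h ^ 4 * (orbit h n).2)
          (by fun_prop) (by norm_num [dblX, dblY]))
    filter_upwards [ih, h9, hN, hD] with h i1 i2 i3 i4
    exact step_onCurve i2 i3 i4 i1

theorem eventually_orbit_gt_one (n : ℕ) : ∀ᶠ h in 𝓝[≠] (0 : ℚ), 1 < (orbit h n).1 := by
  obtain ⟨co, cv⟩ := continuousAt_orbit n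
  refine eventually_nhdsWithin_of_eventually_nhds
    (ContinuousAt.eventually_lt (g := fun h => (orbit h n).1) continuousAt_const
      (by fun_prop) ?_)
  norm_num [cv]

/-- The elementary symmetric function `uv + vw + wu` separates the points of the orbit. -/
theorem eventually_orbit_separated {m n : ℕ} (hmn : m ≠ n) : ∀ᶠ h in 𝓝[≠] (0 : ℚ),
    coeff h / 4 * (orbit h m).1 + (orbit h m).1⁻¹ * (1 - (orbit h m).1⁻¹) ≠
      coeff h / 4 * (orbit h n).1 + (orbit h n).1⁻¹ * (1 - (orbit h n).1⁻¹) := by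
  obtain ⟨cm, vm⟩ := continuousAt_orbit m
  obtain ⟨cn, vn⟩ := continuousAt_orbit n
  have hc : ContinuousAt coeff 0 := by
    unfold coeff
    fun_prop
  have hZ : ∀ᶠ h in 𝓝[≠] (0 : ℚ), (orbit h m).2 ^ 2 - (orbit h n).2 ^ 2 ≠ 0 := by
    refine eventually_ne_zero (f := fun h : ℚ => (orbit h m).2 ^ 2 - (orbit h n).2 ^ 2)
        (by fun_prop) ?_
    simp only [vm, vn]
    intro h
    have h2 : ((m : ℚ) - n) * (m + n + 1) = 0 := by linear_combination h / 4
    rcases mul_eq_zero.1 h2 with h3 | h3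
    · exact hmn (by exact_mod_cast sub_eq_zero.1 h3)
    · have : (0 : ℚ) < m + n + 1 := by positivity
      linarith
  -- This is the cofactor of `X - X'` in the difference of the two symmetric functions, denominators
  -- cleared; at `h = 0` it equals 1.
  have hE : ∀ᶠ h in 𝓝[≠] (0 : ℚ), coeff h / 4 * ((orbit h m).1 * (orbit h n).1) ^ 2
      - (orbit h m).1 * (orbit h n).1 + (orbit h m).1 + (orbit h n).1 ≠ 0 := by
    refine eventually_ne_zero (f := fun h : ℚ => coeff h / 4 * ((orbit h m).1 *
        (orbit h n).1) ^ 2 - (orbit h m).1 * (orbit h n).1 + (orbit h m).1 + (orbit h n).1)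
        (by fun_prop) ?_
    norm_num [vm, vn, coeff]
  filter_upwards [hZ, hE, eventually_orbit_onCurve m, eventually_orbit_onCurve n,
    eventually_orbit_gt_one m, eventually_orbit_gt_one n, self_mem_nhdsWithin]
    with h hZ hE om on pm pn h0 heq
  have h0 : h ≠ 0 := h0
  have pm' : (orbit h m).1 ≠ 0 := by positivity
  have pn' : (orbit h n).1 ≠ 0 := by positivity
  simp only [OnCurve] at om on
  generalize (orbit h m).1 = X at *
  generalize (orbit h n).1 = X' at *
  have key : (X - X') * (coeff h / 4 * (X * X') ^ 2 - X * X' + X + X') = 0 := by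
    field_simp at heq
    linear_combination heq / 4
  rcases mul_eq_zero.1 key with k | k
  -- Equal abscissas force equal squared ordinates, but these tend to `(2m + 1)²` and `(2n + 1)²`.
  · obtain rfl : X = X' := sub_eq_zero.1 k
    apply hZ
    apply mul_left_cancel₀ (pow_ne_zero 2 h0)
    linear_combination om - on
  · exact hE k

/-! ### Rational tangent lengths from curve points -/

/-- A rational triple `(u, v, w)` of positive numbers with sum `1` and product `k²`. -/
structure IsShape (k : ℚ) (x : ℚ × ℚ × ℚ) : Prop where
  pos₁ : 0 < x.1
  pos₂ : 0 < x.2.1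
  pos₃ : 0 < x.2.2
  sum_eq : x.1 + x.2.1 + x.2.2 = 1
  prod_eq : x.1 * x.2.1 * x.2.2 = k ^ 2

/-- The point of `uvw = k²`, `u + v + w = 1` with `1 / w = q.1` and `(u - v) / w = h * q.2`. -/
def shape (h : ℚ) (q : ℚ × ℚ) : ℚ × ℚ × ℚ :=
  ((1 - q.1⁻¹ + h * q.2 / q.1) / 2, (1 - q.1⁻¹ - h * q.2 / q.1) / 2, q.1⁻¹)

theorem isShape_shape {h k : ℚ} {q : ℚ × ℚ} (hk : k ≠ 0) (hkc : k ^ 2 = coeff h / 4)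
    (hq : OnCurve h q) (h1 : 1 < q.1) : IsShape k (shape h q) := by
  obtain ⟨X, Z⟩ := q
  simp only [OnCurve] at *
  have hX : 0 < X := by linarith
  have huv : (1 - X⁻¹ + h * Z / X) / 2 * ((1 - X⁻¹ - h * Z / X) / 2) = k ^ 2 * X := by
    rw [hkc]
    field_simp
    linear_combination -4 * hq
  have hpos : 0 < (1 - X⁻¹ + h * Z / X) / 2 * ((1 - X⁻¹ - h * Z / X) / 2) := by
    rw [huv]; positivity
  have hX1 : X⁻¹ < 1 := inv_lt_one_of_one_lt₀ h1
  have hboth : 0 < (1 - X⁻¹ + h * Z / X) / 2 ∧ 0 < (1 - X⁻¹ - h * Z / X) / 2 := by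
    rcases mul_pos_iff.1 hpos with h' | h'
    · exact h'
    · linarith [h'.1, h'.2]
  refine ⟨hboth.1, hboth.2, inv_pos.2 hX, ?_, ?_⟩
  · simp only [shape]; ring
  · simp only [shape]
    rw [huv, mul_assoc, mul_inv_cancel₀ hX.ne', mul_one]

theorem shape_esymm_two {h : ℚ} {q : ℚ × ℚ} (hq : OnCurve h q) (h1 : 1 < q.1) :
    (shape h q).1 * (shape h q).2.1 + (shape h q).2.2 * ((shape h q).1 + (shape h q).2.1) =
      coeff h / 4 * q.1 + q.1⁻¹ * (1 - q.1⁻¹) := by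
  obtain ⟨X, Z⟩ := q
  simp only [OnCurve, shape] at *
  have hX : 0 < X := by linarith
  field_simp
  linear_combination -4 * hq

/-- Values of `h` for which the product `u v w` is a square. -/
def param (n : ℕ) : ℚ := 3 * (2 * n + 1) / (2 * n * (n + 1) + 1)

/-- The square root of the product `u v w` at `h = param n`. -/
def ratio (n : ℕ) : ℚ := 3 / 8 * (n * (n + 1)) / (2 * n * (n + 1) + 1)

/-- `9 - h ^ 2` is a square by the Pythagorean triple `2n + 1`, `2n(n + 1)`, `2n(n + 1) + 1`. -/
theorem ratio_sq (n : ℕ) : ratio n ^ 2 = coeff (param n) / 4 := by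
  unfold ratio coeff param
  have : (2 * n * (n + 1) + 1 : ℚ) ≠ 0 := by positivity
  field_simp
  ring

theorem ratio_strictMono : StrictMono ratio := by
  refine strictMono_nat_of_lt_succ fun n => ?_
  unfold ratio
  rw [div_lt_div_iff₀ (by positivity) (by positivity), ← sub_pos]
  push_cast
  ring_nf
  positivity

theorem tendsto_param : Tendsto param atTop (𝓝[≠] 0) := by
  refine tendsto_nhdsWithin_iff.2 ⟨?_, Eventually.of_forall fun n => ?_⟩
  · have h3 : Tendsto (fun n : ℕ => (6 : ℚ) * (1 / ((n : ℚ) + 1))) atTop (𝓝 (6 * 0)) :=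
      (tendsto_one_div_add_atTop_nhds_zero_nat (𝕜 := ℚ)).const_mul 6
    rw [mul_zero] at h3
    refine tendsto_of_tendsto_of_tendsto_of_le_of_le tendsto_const_nhds h3
      (fun n => by unfold param; positivity) (fun n => ?_)
    unfold param
    rw [mul_one_div, div_le_div_iff₀ (by positivity) (by positivity), ← sub_nonneg]
    ring_nf
    positivity
  · have : 0 < param n := by unfold param; positivity
    exact this.ne'

theorem exists_shapes (N : ℕ) : ∃ k : ℕ → ℚ, StrictMono k ∧ ∀ s, 0 < k s ∧
    ∃ x : Fin N → ℚ × ℚ × ℚ, (∀ i, IsShape (k s) (x i)) ∧ ∀ i j, i ≠ j →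
      (x i).1 * (x i).2.1 + (x i).2.2 * ((x i).1 + (x i).2.1) ≠
        (x j).1 * (x j).2.1 + (x j).2.2 * ((x j).1 + (x j).2.1) := by
  have hev : ∀ᶠ h in 𝓝[≠] (0 : ℚ), (∀ i : Fin N, OnCurve h (orbit h i) ∧ 1 < (orbit h i).1) ∧
      ∀ i j : Fin N, i ≠ j →
        coeff h / 4 * (orbit h i).1 + (orbit h i).1⁻¹ * (1 - (orbit h i).1⁻¹) ≠
          coeff h / 4 * (orbit h j).1 + (orbit h j).1⁻¹ * (1 - (orbit h j).1⁻¹) := by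
    simp only [eventually_and, eventually_all]
    refine ⟨fun i => ⟨eventually_orbit_onCurve i, eventually_orbit_gt_one i⟩, fun i j hij =>
      eventually_orbit_separated fun h => hij (Fin.ext h)⟩
  obtain ⟨M, hM⟩ := eventually_atTop.1 (tendsto_param.eventually hev)
  -- The shift by 1 avoids `ratio 0 = 0`.
  refine ⟨fun s => ratio (M + 1 + s), fun a b hab => ratio_strictMono (by omega), fun s => ?_⟩
  have hpos : 0 < ratio (M + 1 + s) := by
    unfold ratio
    push_cast
    positivity
  obtain ⟨h1, h2⟩ := hM (M + 1 + s) (by omega)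
  refine ⟨hpos, fun i => shape (param (M + 1 + s)) (orbit (param (M + 1 + s)) i), fun i =>
    isShape_shape hpos.ne' (ratio_sq _) (h1 i).1 (h1 i).2, fun i j hij => ?_⟩
  rw [shape_esymm_two (h1 i).1 (h1 i).2,
    shape_esymm_two (h1 j).1 (h1 j).2]
  exact h2 i j hij

end HeronCurve

namespace PlaneTriangle

/-! ### Plane triangles: area, Heron's formula, similarity -/

/-- The triangle with vertices `(y, x)`, `(0, 0)`, `(0, a)`. -/
def verts (a x y : ℝ) : Fin 3 → EuclideanSpace ℝ (Fin 2) := ![!₂[y, x], !₂[0, 0], !₂[0, a]]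

theorem affineIndependent_verts {a x y : ℝ} (ha : 0 < a) (hy : 0 < y) :
    AffineIndependent ℝ (verts a x y) := by
  rw [affineIndependent_iff_of_fintype]
  intro w hw h
  rw [Finset.weightedVSub_eq_linear_combination (hw := hw)] at h
  have h0 := congrArg (fun v : EuclideanSpace ℝ (Fin 2) => v 0) h
  have h1 := congrArg (fun v : EuclideanSpace ℝ (Fin 2) => v 1) h
  simp [Fin.sum_univ_three, verts] at h0 h1 hw
  have e0 : w 0 = 0 := by rcases h0 with h | h <;> [exact h; linarith]
  rw [e0] at h1 hw
  simp at h1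
  have e2 : w 2 = 0 := by rcases h1 with h | h <;> [exact h; linarith]
  intro i
  fin_cases i
  · exact e0
  · simpa [e2] using hw
  · exact e2

theorem convexHull_verts {a x y : ℝ} (ha : 0 < a) (hy : 0 < y) :
    convexHull ℝ (Set.range (verts a x y)) =
      {p | p 0 ∈ Set.Icc 0 y ∧ p 1 ∈ Set.Icc (x / y * p 0) (a + (x - a) / y * p 0)} := by
  apply Set.Subset.antisymm
  · apply convexHull_min
    · rintro _ ⟨i, rfl⟩
      fin_cases i
      · simp [verts, hy.le, hy.ne']
      · simp [verts, hy.le, ha.le]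
      · simp [verts, hy.le, ha.le]
    · rintro p ⟨⟨h1, h2⟩, h3, h4⟩ q ⟨⟨h5, h6⟩, h7, h8⟩ s t hs ht hst
      simp only [Set.mem_ofPred_eq, PiLp.add_apply, PiLp.smul_apply, smul_eq_mul, Set.mem_Icc]
      obtain rfl : t = 1 - s := by linarith
      refine ⟨⟨by positivity, ?_⟩, ?_, ?_⟩
      · nlinarith
      · linarith [mul_le_mul_of_nonneg_left h3 hs, mul_le_mul_of_nonneg_left h7 ht]
      · linarith [mul_le_mul_of_nonneg_left h4 hs, mul_le_mul_of_nonneg_left h8 ht]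
  · rintro p ⟨⟨h1, h2⟩, h3, h4⟩
    -- The weights are the barycentric coordinates of `p`.
    have key := (convex_convexHull ℝ (Set.range (verts a x y))).sum_mem (t := Finset.univ)
      (w := ![p 0 / y, 1 - p 0 / y - (p 1 - x / y * p 0) / a, (p 1 - x / y * p 0) / a])
      (z := verts a x y) ?_ ?_ (fun i _ => subset_convexHull ℝ _ ⟨i, rfl⟩)
    · convert key using 1
      ext i
      fin_cases i
      · simp [Fin.sum_univ_three, verts]; field_simp
      · simp [Fin.sum_univ_three, verts]; field_simp; ring
    · intro i _
      fin_cases i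
      · simp; positivity
      · have : (p 1 - x / y * p 0) / a ≤ 1 - p 0 / y := by
          rw [div_le_iff₀ ha]
          have : (1 - p 0 / y) * a = a + (x - a) / y * p 0 - x / y * p 0 := by ring
          linarith
        simp; linarith
      · simpa using div_nonneg (sub_nonneg.2 h3) ha.le
    · simp [Fin.sum_univ_three]; ring

theorem volume_convexHull_verts {a x y : ℝ} (ha : 0 < a) (hy : 0 < y) :
    volume.real (convexHull ℝ (Set.range (verts a x y))) = a * y / 2 := by
  rw [convexHull_verts ha hy]
  set S : Set (ℝ × ℝ) :=
    {p | p.1 ∈ Set.Icc 0 y ∧ p.2 ∈ Set.Icc (x / y * p.1) (a + (x - a) / y * p.1)} with hS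
  have hSm : MeasurableSet S := by
    apply IsClosed.measurableSet
    simp only [hS, Set.mem_Icc]
    refine (IsClosed.and ?_ ?_).and (IsClosed.and ?_ ?_) <;>
      exact isClosed_le (by fun_prop) (by fun_prop)
  have hpre : {p : EuclideanSpace ℝ (Fin 2) |
      p 0 ∈ Set.Icc 0 y ∧ p 1 ∈ Set.Icc (x / y * p 0) (a + (x - a) / y * p 0)} =
      (MeasurableEquiv.finTwoArrow ∘ WithLp.ofLp) ⁻¹' S := rfl
  rw [hpre, measureReal_def, ((volume_preserving_finTwoArrow ℝ).comp
    (PiLp.volume_preserving_ofLp (Fin 2))).measure_preimage hSm.nullMeasurableSet,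
    Measure.volume_eq_prod, Measure.prod_apply hSm]
  have hslice : ∀ t, volume (Prod.mk t ⁻¹' S) =
      (Set.Icc 0 y).indicator (fun t => ENNReal.ofReal (a - a / y * t)) t := by
    intro t
    by_cases ht : t ∈ Set.Icc 0 y
    · have : Prod.mk t ⁻¹' S = Set.Icc (x / y * t) (a + (x - a) / y * t) := by
        ext z
        simp only [hS, Set.mem_preimage, Set.mem_ofPred_eq]
        tauto
      rw [this, Set.indicator_of_mem ht, Real.volume_Icc]
      congr 1
      ring
    · have : Prod.mk t ⁻¹' S = ∅ := by
        ext z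
        simp only [hS, Set.mem_preimage, Set.mem_ofPred_eq, Set.mem_empty_iff_false]
        tauto
      rw [this, Set.indicator_of_notMem ht, measure_empty]
  simp_rw [hslice]
  rw [lintegral_indicator measurableSet_Icc, ← ofReal_integral_eq_lintegral_ofReal]
  · rw [integral_Icc_eq_integral_Ioc, ← intervalIntegral.integral_of_le hy.le,
      intervalIntegral.integral_sub (by simp) (by apply Continuous.intervalIntegrable; fun_prop),
      intervalIntegral.integral_const_mul, integral_id, intervalIntegral.integral_const,
      ENNReal.toReal_ofReal]
    · simp; field_simp; ring
    · simp; field_simp; nlinarith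
  · exact (Continuous.continuousOn (by fun_prop)).integrableOn_Icc
  · refine (ae_restrict_mem measurableSet_Icc).mono fun t ht => ?_
    have : a / y * t ≤ a / y * y := mul_le_mul_of_nonneg_left ht.2 (by positivity)
    rw [div_mul_cancel₀ _ hy.ne'] at this
    simpa using this

/-- Existence of a triangle with given tangent lengths, by Heron's formula. -/
theorem exists_of_tangent_lengths {u v w A : ℝ} (hu : 0 < u) (hv : 0 < v) (hw : 0 < w)
    (hA : 0 < A) (h : A ^ 2 = (u + v + w) * (u * v * w)) :
    ∃ T : PlaneTriangle, T.side 0 = v + w ∧ T.side 1 = u + w ∧ T.side 2 = u + v ∧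
      T.area = A := by
  have ha : 0 < v + w := by linarith
  have hy : 0 < 2 * A / (v + w) := by positivity
  -- The law of cosines gives the foot `x` of the altitude on the side `v + w`; the area gives its
  -- height `y`.
  set x := ((v + w) ^ 2 + (u + v) ^ 2 - (u + w) ^ 2) / (2 * (v + w)) with hx
  set y := 2 * A / (v + w) with hyd
  have hxa : x * (2 * (v + w)) = (v + w) ^ 2 + (u + v) ^ 2 - (u + w) ^ 2 := by
    rw [hx]; field_simp
  have hya : y * (v + w) = 2 * A := by rw [hyd]; field_simp
  have e1 : y ^ 2 + x ^ 2 = (u + v) ^ 2 := by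
    apply mul_left_cancel₀ (pow_ne_zero 2 ha.ne')
    have : (y * (v + w)) ^ 2 + (x * (2 * (v + w))) ^ 2 / 4 = (v + w) ^ 2 * (u + v) ^ 2 := by
      rw [hya, hxa, mul_pow, h]; ring
    linear_combination this
  have e2 : y ^ 2 + (v + w - x) ^ 2 = (u + w) ^ 2 := by linear_combination e1 - hxa
  refine ⟨⟨verts (v + w) x y, affineIndependent_verts ha hy⟩, ?_, ?_, ?_, ?_⟩
  · change dist (verts (v + w) x y 1) (verts (v + w) x y 2) = _
    simp only [verts, EuclideanSpace.dist_eq, Fin.sum_univ_two, Real.dist_eq, sq_abs]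
    rw [Real.sqrt_eq_iff_eq_sq (by positivity) ha.le]
    simp
    ring
  · change dist (verts (v + w) x y 2) (verts (v + w) x y 0) = _
    simp only [verts, EuclideanSpace.dist_eq, Fin.sum_univ_two, Real.dist_eq, sq_abs]
    rw [Real.sqrt_eq_iff_eq_sq (by positivity) (by positivity), ← e2]
    simp
  · change dist (verts (v + w) x y 0) (verts (v + w) x y 1) = _
    simp only [verts, EuclideanSpace.dist_eq, Fin.sum_univ_two, Real.dist_eq, sq_abs]
    rw [Real.sqrt_eq_iff_eq_sq (by positivity) (by positivity), ← e1]
    simp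
  · rw [area, volume_convexHull_verts ha hy]
    linarith

theorem perimeter_eq (T : PlaneTriangle) : T.perimeter = T.side 0 + T.side 1 + T.side 2 :=
  Fin.sum_univ_three _

/-- The double sum is visibly invariant under relabelling, so similarity can be tested on power sums
of the sides without tracking the permutation. -/
theorem sum_dist_pow (T : PlaneTriangle) {n : ℕ} (hn : n ≠ 0) :
    ∑ i : Fin 3, ∑ j : Fin 3, dist (T.points i) (T.points j) ^ n =
      2 * (T.side 0 ^ n + T.side 1 ^ n + T.side 2 ^ n) := by
  have h0 : T.side 0 = dist (T.points 1) (T.points 2) := rfl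
  have h1 : T.side 1 = dist (T.points 2) (T.points 0) := rfl
  have h2 : T.side 2 = dist (T.points 0) (T.points 1) := rfl
  simp only [Fin.sum_univ_three, dist_self, zero_pow hn, h0, h1, h2,
    dist_comm (T.points 1) (T.points 0), dist_comm (T.points 2) (T.points 0),
    dist_comm (T.points 2) (T.points 1)]
  ring

theorem perimeter_pos (T : PlaneTriangle) : 0 < T.perimeter := by
  have : T.points 1 ≠ T.points 2 := T.independent.injective.ne (by decide)
  have h0 : 0 < T.side 0 := dist_pos.2 this
  have h1 : 0 ≤ T.side 1 := dist_nonneg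
  have h2 : 0 ≤ T.side 2 := dist_nonneg
  rw [perimeter_eq]
  linarith

/-- Similar triangles of equal perimeter have the same sum of squared sides. -/
theorem IsSimilar.sum_sq_side_eq {T T' : PlaneTriangle} (h : T.IsSimilar T')
    (hp : T.perimeter = T'.perimeter) :
    T.side 0 ^ 2 + T.side 1 ^ 2 + T.side 2 ^ 2 = T'.side 0 ^ 2 + T'.side 1 ^ 2 + T'.side 2 ^ 2 := by
  obtain ⟨e, he⟩ := h
  obtain ⟨r, -, hr⟩ := similar_iff_exists_dist_eq.1 he
  have hsum : ∀ n ≠ 0, T.side 0 ^ n + T.side 1 ^ n + T.side 2 ^ n =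
      (r : ℝ) ^ n * (T'.side 0 ^ n + T'.side 1 ^ n + T'.side 2 ^ n) := by
    intro n hn
    have h1 : ∑ i : Fin 3, ∑ j : Fin 3, dist (T.points i) (T.points j) ^ n =
        ∑ i : Fin 3, ∑ j : Fin 3, dist ((T.points ∘ e) i) ((T.points ∘ e) j) ^ n := by
      rw [← Equiv.sum_comp e]
      refine Finset.sum_congr rfl fun i _ => ?_
      rw [← Equiv.sum_comp e]
      rfl
    simp_rw [hr, mul_pow, ← Finset.mul_sum] at h1
    rw [sum_dist_pow T hn, sum_dist_pow T' hn] at h1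
    linarith
  have h1 := hsum 1 one_ne_zero
  simp only [pow_one, ← perimeter_eq, hp] at h1
  have : (r : ℝ) = 1 := by
    apply mul_right_cancel₀ T'.perimeter_pos.ne'
    linarith
  rw [hsum 2 two_ne_zero, this]
  ring

end PlaneTriangle

/-! ### Clearing denominators and assembling the family -/

theorem exists_common_den (S : Finset ℚ) :
    ∃ m : ℕ, 0 < m ∧ ∀ q ∈ S, ∃ z : ℤ, (m : ℝ) * (q : ℝ) = z := by
  refine ⟨∏ q ∈ S, q.den, Finset.prod_pos fun q _ => q.den_pos, fun q hq => ?_⟩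
  obtain ⟨c, hc⟩ := Finset.dvd_prod_of_mem (fun q : ℚ => q.den) hq
  refine ⟨c * q.num, ?_⟩
  have h : ((∏ q ∈ S, q.den : ℕ) : ℚ) * q = c * q.num := by
    rw [hc, ← Rat.mul_den_eq_num q]
    push_cast
    ring
  exact_mod_cast congrArg (fun t : ℚ => (t : ℝ)) h

open HeronCurve in
theorem exists_heron_of_shapes {N : ℕ} {k : ℚ} (hk : 0 < k) {x : Fin N → ℚ × ℚ × ℚ}
    (hx : ∀ i, IsShape k (x i))
    (hne : ∀ i j, i ≠ j → (x i).1 * (x i).2.1 + (x i).2.2 * ((x i).1 + (x i).2.1) ≠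
        (x j).1 * (x j).2.1 + (x j).2.2 * ((x j).1 + (x j).2.1)) :
    ∃ (Δ : Fin N → PlaneTriangle) (A p : ℝ), (∀ i, (Δ i).IsHeron) ∧
      (∀ i j, i ≠ j → ¬ (Δ i).IsSimilar (Δ j)) ∧
      (∀ i, (Δ i).area = A ∧ (Δ i).perimeter = p) ∧ A / p ^ 2 = k / 4 := by
  -- Including `k` makes the scaled area `m ^ 2 * k = m * (m * k)` an integer.
  obtain ⟨m, hm, hint⟩ := exists_common_den
    (insert k (Finset.univ.biUnion fun i => {(x i).1, (x i).2.1, (x i).2.2}))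
  obtain ⟨K, hK⟩ := hint k (by simp)
  have hm' : (0 : ℝ) < m := by exact_mod_cast hm
  have hk' : (0 : ℝ) < k := by exact_mod_cast hk
  have hsum : ∀ i, ((x i).1 : ℝ) + (x i).2.1 + (x i).2.2 = 1 := fun i => by
    exact_mod_cast (hx i).sum_eq
  have hT : ∀ i, ∃ T : PlaneTriangle, T.side 0 = m * (x i).2.1 + m * (x i).2.2 ∧
      T.side 1 = m * (x i).1 + m * (x i).2.2 ∧ T.side 2 = m * (x i).1 + m * (x i).2.1 ∧
      T.area = m ^ 2 * k := by
    intro i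
    have h1 : (0 : ℝ) < (x i).1 := by exact_mod_cast (hx i).pos₁
    have h2 : (0 : ℝ) < (x i).2.1 := by exact_mod_cast (hx i).pos₂
    have h3 : (0 : ℝ) < (x i).2.2 := by exact_mod_cast (hx i).pos₃
    have hprod : ((x i).1 : ℝ) * (x i).2.1 * (x i).2.2 = k ^ 2 := by
      exact_mod_cast (hx i).prod_eq
    refine PlaneTriangle.exists_of_tangent_lengths (mul_pos hm' h1) (mul_pos hm' h2)
      (mul_pos hm' h3) (by positivity) ?_
    linear_combination -(m : ℝ) ^ 4 * hprod -
      (m : ℝ) ^ 4 * ((x i).1 * (x i).2.1 * (x i).2.2) * hsum i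
  choose T h0 h1 h2 hA using hT
  have hp : ∀ i, (T i).perimeter = 2 * m := fun i => by
    rw [PlaneTriangle.perimeter_eq, h0, h1, h2]
    linear_combination 2 * (m : ℝ) * hsum i
  refine ⟨T, m ^ 2 * k, 2 * m, fun i => ⟨?_, m * K, ?_⟩, fun i j hij hs => ?_,
    fun i => ⟨hA i, hp i⟩, ?_⟩
  · obtain ⟨a, ha⟩ := hint (x i).1 (by simp; exact .inr ⟨i, by simp⟩)
    obtain ⟨b, hb⟩ := hint (x i).2.1 (by simp; exact .inr ⟨i, by simp⟩)
    obtain ⟨c, hc⟩ := hint (x i).2.2 (by simp; exact .inr ⟨i, by simp⟩)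
    intro l
    fin_cases l
    · exact ⟨b + c, by push_cast; rw [← hb, ← hc]; exact h0 i⟩
    · exact ⟨a + c, by push_cast; rw [← ha, ← hc]; exact h1 i⟩
    · exact ⟨a + b, by push_cast; rw [← ha, ← hb]; exact h2 i⟩
  · rw [hA]
    push_cast
    rw [← hK]
    ring
  · have hq := hs.sum_sq_side_eq ((hp i).trans (hp j).symm)
    rw [h0, h1, h2, h0, h1, h2] at hq
    apply hne i j hij
    have : ((x i).1 : ℝ) * (x i).2.1 + (x i).2.2 * ((x i).1 + (x i).2.1) =
        (x j).1 * (x j).2.1 + (x j).2.2 * ((x j).1 + (x j).2.1) := by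
      apply mul_left_cancel₀ (pow_ne_zero 2 hm'.ne')
      linear_combination -hq / 2 +
        (m : ℝ) ^ 2 * (((x i).1 : ℝ) + (x i).2.1 + (x i).2.2 + 1) * hsum i -
        (m : ℝ) ^ 2 * (((x j).1 : ℝ) + (x j).2.1 + (x j).2.2 + 1) * hsum j
    exact_mod_cast this
  · field_simp
    norm_num

theorem mainTheorem2 (N : ℕ) (hN : 0 < N) :
    ∃ (Δ : ℕ+ → Fin N → PlaneTriangle) (A p : ℕ+ → ℝ),
      (∀ s i, (Δ s i).IsHeron) ∧
      (∀ s i j, i ≠ j → ¬ (Δ s i).IsSimilar (Δ s j)) ∧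
      (∀ s i, (Δ s i).area = A s ∧ (Δ s i).perimeter = p s) ∧
      (∀ s s', s ≠ s' → A s / p s ^ 2 ≠ A s' / p s' ^ 2) := by
  obtain ⟨k, hk, h⟩ := HeronCurve.exists_shapes N
  choose hpos x hx hne using h
  choose Δ A p h1 h2 h3 h4 using fun s => exists_heron_of_shapes (hpos s) (hx s) (hne s)
  refine ⟨fun s => Δ s, fun s => A s, fun s => p s, fun s => h1 s, fun s => h2 s,
    fun s => h3 s, fun s s' hs heq => hs ?_⟩
  simp only [h4] at heq
  have : k s = k s' := by
    have : (k s : ℝ) = k s' := by linarith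
    exact_mod_cast this
  exact PNat.coe_injective (hk.injective this)
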